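/- Let $M_d$ be the space of complex $d\times d$ matrices with the Hilbert--Schmidt inner product $\langle X,Y\rangle=\operatorname{Tr}X^*Y$. For positive definite $A,B\in M_d$ let $\Delta_{AB}=L_AR_B^{-1}$, i.e. $\Delta_{AB}(X)=AXB^{-1}$, a positive definite operator on $M_d$. For $p\in(0,2)$ and $x>0$ put $$g_p(x)=\frac{x-x^p}{p(1-p)}\ \ (p\neq 1),\qquad g_1(x)=x\log x,$$ and for $K\in M_d$ define $$J_p(K,A,B)=\operatorname{Tr}\,\sqrt B\,K^*\,g_p(\Delta_{AB})(K\sqrt B),$$ where $g_p(\Delta_{AB})$ is given by the spectral theorem. Let $m\ge 1$, let $A_1,\dots,A_m,B_1,\dots,B_m\in M_d$ be positive definite, let $A=\sum_jA_j$, $B=\sum_jB_j$, and let $K\in M_d$ be an arbitrary fixed matrix. Then the following are equivalent: (a) $J_p(K,A,B)=\sum_jJ_p(K,A_j,B_j)$ for all $p\in(0,2)$; (b) $J_p(K,A,B)=\sum_jJ_p(K,A_j,B_j)$ for some $p\in(0,2)$; (c) $(\Delta_{A_jB_j}+tI)^{-1}(K)=(\Delta_{AB}+tI)^{-1}(K)$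 for all $j$ and all $t>0$; (d) $A_j^{it}KB_j^{-it}=A^{it}KB^{-it}$ for all $j$ and all $t>0$; (e) $(\log A-\log A_j)K=K(\log B-\log B_j)$ for all $j$. -/

import Mathlib

open scoped ComplexOrder

noncomputable section

namespace WYD

variable {n : Type*} [Fintype n] [DecidableEq n]

/-- The relative modular operator `Δ_{AB} = L_A R_B⁻¹`, that is `X ↦ A X B⁻¹`, as a linear operator
on the space of `n × n` complex matrices. -/
def modularOp (A B : Matrix n n ℂ) : Module.End ℂ (Matrix n n ℂ) :=
  LinearMap.mulLeft ℂ A * LinearMap.mulRight ℂ B⁻¹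

/-- Functional calculus `f(T)` of a linear operator `T` on the space of `n × n` complex matrices
that is self-adjoint for the Hilbert–Schmidt inner product `⟨X, Y⟩ = Tr X* Y`.
The matrix units form an orthonormal basis for this inner product; `f(T)` is obtained by applying
the functional calculus of Hermitian matrices to the matrix of `T` in that basis. -/
def opCalc (f : ℝ → ℝ) (T : Module.End ℂ (Matrix n n ℂ)) : Module.End ℂ (Matrix n n ℂ) :=
  Matrix.toLin (Matrix.stdBasis ℂ n n) (Matrix.stdBasis ℂ n n)
    (cfc f (LinearMap.toMatrix (Matrix.stdBasis ℂ n n) (Matrix.stdBasis ℂ n n) T))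

/-- The function `g_p` on `(0, ∞)`: `(x - x ^ p) / (p (1 - p))` for `p ≠ 1`, and `x log x` for
`p = 1`. -/
def g (p x : ℝ) : ℝ :=
  if p = 1 then x * Real.log x else 1 / (p * (1 - p)) * (x - x ^ p)

/-- `J_p(K, A, B) = Tr √B K* g_p(L_A R_B⁻¹)(K √B)`, for `A`, `B` positive definite. -/
def J (p : ℝ) (K A B : Matrix n n ℂ) : ℂ :=
  (cfc Real.sqrt B * K.conjTranspose *
    opCalc (g p) (modularOp A B) (K * cfc Real.sqrt B)).trace

/-- The logarithm of a positive definite matrix. -/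
def logM (A : Matrix n n ℂ) : Matrix n n ℂ := cfc Real.log A

/-- The complex power `A ^ z = exp (z log A)` of a positive definite matrix. -/
def cpowM (A : Matrix n n ℂ) (z : ℂ) : Matrix n n ℂ := NormedSpace.exp (z • logM A)

end WYD

end

/-!
Write `Δ = Δ_{AB}` and `Δⱼ = Δ_{AⱼBⱼ}`. Since functions of `Δ` commute with right multiplication by
`√B`, `J p K A B = Tr K* g_p(Δ)(K) B` (`WYD.J_eq_trace`). The convexity defect
`D(f) = ∑ⱼ Tr K* f(Δⱼ)(K) Bⱼ - Tr K* f(Δ)(K) B` (`WYD.defect`) is therefore a finite combination of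
values of `f` at positive reals, it vanishes on affine functions, and equality for `J p` means
`D(g_p) = 0`.

For `f(x) = (x + t)⁻¹` the element `W = f(Δ)(K)` solves `A W + t W B = K B`. The operator
`S(Y) = A Y + t Y B` is positive definite and, like `K B`, additive in `(A, B)`, so completing the
square gives `D(f) = ∑ⱼ Tr (Wⱼ - W)* Sⱼ(Wⱼ - W) ≥ 0`, with equality only if all `Wⱼ = W`
(`WYD.sum_traceForm_resolvent_sub`). For `0 < p < 2` the function `g_p` is, up to an affine
function, an integral of the functions `(x + t)⁻¹` with the positive density `C t ^ p`
(`WYD.g_integral_representation`). Hence `D(g_p) = 0` for a single `p` forces the resolvents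
of `Δⱼ` and `Δ` to agree on `K` (`WYD.resolvent_eq_zero_of_g_eq_zero`).

Agreement of the resolvents gives `f(Δⱼ)(K) = f(Δ)(K)` for every `f`, as on the finite spectra `f`
is a combination of resolvent functions by partial fractions (`WYD.exists_eq_sum_inv_add`). This
gives equality for all `p` and, with `f(x) = x ^ (it)`, the condition on imaginary powers; its
derivative at `t = 0` is the condition on logarithms. That condition in turn gives equality for
`p = 1`, because `Tr K* (Δ log Δ)(K) B = Tr K* A (log A K - K log B)` (`WYD.defect_g_one`).
-/

noncomputable section

namespace WYD

section Scalar

open MeasureTheory Set Filter Topology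

/-! ### Integral representation of `g p` -/

/-- The case `p = 1`: the integrand is `t (x - 1)² / ((x + t) (1 + t)²)`, which has an elementary
antiderivative. -/
theorem g_one_integral_representation {x : ℝ} (hx : 0 < x) :
    IntegrableOn (fun t : ℝ => t ^ (1 : ℝ) *
      ((x + t)⁻¹ + (-(1 + t)⁻¹ - ((1 + t) ^ 2)⁻¹) + ((1 + t) ^ 2)⁻¹ * x)) (Ioi 0) ∧
    ∫ t in Ioi (0 : ℝ), t ^ (1 : ℝ) *
      ((x + t)⁻¹ + (-(1 + t)⁻¹ - ((1 + t) ^ 2)⁻¹) + ((1 + t) ^ 2)⁻¹ * x) =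
      x * Real.log x - x + 1 := by
  set k : ℝ → ℝ := fun t => t ^ (1 : ℝ) *
      ((x + t)⁻¹ + (-(1 + t)⁻¹ - ((1 + t) ^ 2)⁻¹) + ((1 + t) ^ 2)⁻¹ * x) with hk
  -- `G` is the antiderivative of `k` that vanishes at infinity.
  let G : ℝ → ℝ := fun t => x * (Real.log (1 + t) - Real.log (x + t)) + (x - 1) * (1 + t)⁻¹
  have hder : ∀ t ∈ Ici (0 : ℝ), HasDerivAt G (k t) t := by
    intro t ht
    have ht : 0 ≤ t := ht
    have h1 : HasDerivAt (fun s : ℝ => 1 + s) 1 t := (hasDerivAt_id t).const_add 1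
    have h2 : HasDerivAt (fun s : ℝ => x + s) 1 t := (hasDerivAt_id t).const_add x
    have n1 : 1 + t ≠ 0 := by positivity
    have n2 : x + t ≠ 0 := by positivity
    have hval : k t = x * (1 / (1 + t) - 1 / (x + t)) + (x - 1) * (-1 / (1 + t) ^ 2) := by
      simp only [hk, Real.rpow_one]
      field_simp
      ring
    rw [hval]
    exact (((h1.log n1).sub (h2.log n2)).const_mul x).add ((h1.inv n1).const_mul (x - 1))
  have hpos : ∀ t ∈ Ioi (0 : ℝ), 0 ≤ k t := by
    intro t ht
    have ht : 0 < t := ht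
    have : k t = t * (x - 1) ^ 2 / ((x + t) * (1 + t) ^ 2) := by
      simp only [hk, Real.rpow_one]
      field_simp
      ring
    rw [this]
    positivity
  have hlim : Tendsto G atTop (𝓝 0) := by
    have h1 := Real.tendsto_log_comp_add_sub_log 1
    have h2 := Real.tendsto_log_comp_add_sub_log x
    have h3 : Tendsto (fun t : ℝ => (1 + t)⁻¹) atTop (𝓝 0) :=
      tendsto_inv_atTop_zero.comp (tendsto_atTop_add_const_left _ _ tendsto_id)
    have := ((h1.sub h2).const_mul x).add (h3.const_mul (x - 1))
    simp only [sub_zero, mul_zero, add_zero] at this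
    refine this.congr fun t => ?_
    simp only [G, add_comm t]
    ring
  refine ⟨integrableOn_Ioi_deriv_of_nonneg' hder hpos hlim, ?_⟩
  rw [integral_Ioi_of_hasDerivAt_of_nonneg' hder hpos hlim]
  simp [G]
  ring

/-- Up to an affine function, `g p` is a positive combination of the functions
`x ↦ (x + t)⁻¹`, `t > 0`, with density a positive multiple of `t ^ p`; the affine terms `α t`, `β t`
in the integrand make the integral converge. This is where the range `0 < p < 2` enters. -/
theorem g_integral_representation {p : ℝ} (hp : p ∈ Ioo (0 : ℝ) 2) :
    ∃ (C a b : ℝ) (α β : ℝ → ℝ), 0 < C ∧ ∀ x : ℝ, 0 < x →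
      IntegrableOn (fun t : ℝ => t ^ p * ((x + t)⁻¹ + α t + β t * x)) (Ioi 0) ∧
      g p x = a + b * x + C * ∫ t in Ioi (0 : ℝ), t ^ p * ((x + t)⁻¹ + α t + β t * x) := by
  rcases lt_trichotomy p 1 with h1 | rfl | h1
  · have hp' : p ∈ Ioo (0 : ℝ) 1 := ⟨hp.1, h1⟩
    have hc := Real.integral_rpowIntegrand₀₁_one_pos hp'
    set c := ∫ t in Ioi 0, Real.rpowIntegrand₀₁ p t 1
    have hpp : 0 < p * (1 - p) := mul_pos hp.1 (by linarith)
    refine ⟨(p * (1 - p))⁻¹ * c⁻¹, 0, (p * (1 - p))⁻¹, fun t => -t⁻¹, fun _ => 0, by positivity,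
      fun x hx => ?_⟩
    have hf : (fun t : ℝ => t ^ p * ((x + t)⁻¹ + -t⁻¹ + 0 * x)) =
        fun t => -Real.rpowIntegrand₀₁ p t x := by
      funext t
      rw [Real.rpowIntegrand₀₁, add_comm x t]
      ring
    refine ⟨?_, ?_⟩
    · rw [hf]
      exact (Real.integrableOn_rpowIntegrand₀₁_Ioi hp' hx.le).neg
    · rw [hf, integral_neg, g, if_neg h1.ne, Real.rpow_eq_const_mul_integral hp' hx.le]
      ring
  · refine ⟨1, -1, 1, fun t => -(1 + t)⁻¹ - ((1 + t) ^ 2)⁻¹, fun t => ((1 + t) ^ 2)⁻¹, one_pos,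
      fun x hx => ?_⟩
    obtain ⟨h2, h3⟩ := g_one_integral_representation hx
    refine ⟨h2, ?_⟩
    rw [h3, g, if_pos rfl]
    ring
  · have hp' : p ∈ Ioo (1 : ℝ) 2 := ⟨h1, hp.2⟩
    have hc := Real.integral_rpowIntegrand₀₁_one_pos (p := p - 1) ⟨by linarith, by linarith [hp.2]⟩
    set c := ∫ t in Ioi 0, Real.rpowIntegrand₀₁ (p - 1) t 1 with hcdef
    have hpp : 0 < p * (p - 1) := mul_pos hp.1 (by linarith)
    refine ⟨(p * (p - 1))⁻¹ * c⁻¹, 0, -(p * (p - 1))⁻¹, fun t => -t⁻¹, fun t => (t ^ 2)⁻¹,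
      by positivity, fun x hx => ?_⟩
    have hf : EqOn (fun t : ℝ => Real.rpowIntegrand₁₂ p t x)
        (fun t : ℝ => t ^ p * ((x + t)⁻¹ + -t⁻¹ + (t ^ 2)⁻¹ * x)) (Ioi 0) := by
      intro t ht
      have ht : 0 < t := ht
      simp only [Real.rpowIntegrand₁₂, Real.rpow_sub_one ht.ne']
      field_simp
      ring
    refine ⟨(Real.integrableOn_rpowIntegrand₁₂ hp' hx.le).congr_fun hf measurableSet_Ioi, ?_⟩
    rw [← setIntegral_congr_fun measurableSet_Ioi hf, g, if_neg h1.ne',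
      Real.rpow_eq_const_mul_integral_rpowIntegrand₁₂ hp' hx.le, ← hcdef,
      show p * (1 - p) = -(p * (p - 1)) by ring, one_div, inv_neg]
    ring

/-! ### Finite combinations of evaluations and the resolvent functions -/

/-- On a finite set of positive reals every function is a linear combination of the functions
`x ↦ (x + t)⁻¹`, `t > 0`. -/
theorem exists_eq_sum_inv_add (F : Finset ℝ) (hF : ∀ x ∈ F, 0 < x) (f : ℝ → ℂ) :
    ∃ (N : ℕ) (c : ℕ → ℂ), ∀ x ∈ F,
      f x = ∑ i ∈ Finset.range N, c i * ((x : ℂ) + ((i + 1 : ℝ) : ℂ))⁻¹ := by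
  let v : ℕ → ℂ := fun i => -((i + 1 : ℝ) : ℂ)
  let s := Finset.range F.card
  have hv : Function.Injective v := by
    intro i j h
    simpa [v] using h
  have hne : ∀ x ∈ F, ∀ i ∈ s, (x : ℂ) ≠ v i := by
    intro x hx i _ h
    have h' : x = -(i + 1 : ℝ) := by
      apply Complex.ofReal_injective
      rw [h]
      simp [v]
    have := hF x hx
    have : (0 : ℝ) ≤ i := Nat.cast_nonneg i
    linarith
  -- `q` has degree less than the number of nodes, so dividing it by the nodal polynomial gives a
  -- sum of simple fractions.
  let q := Lagrange.interpolate F (fun x : ℝ => (x : ℂ))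
    (fun x => f x * (Lagrange.nodal s v).eval (x : ℂ))
  have hq : q = Lagrange.interpolate s v (fun i => q.eval (v i)) := by
    refine Lagrange.eq_interpolate_of_eval_eq _ hv.injOn ?_ fun _ _ => rfl
    rw [Finset.card_range]
    exact Lagrange.degree_interpolate_lt _ Complex.ofReal_injective.injOn
  refine ⟨F.card, fun i => Lagrange.nodalWeight s v i * q.eval (v i), fun x hx => ?_⟩
  have h1 : q.eval (x : ℂ) = f x * (Lagrange.nodal s v).eval (x : ℂ) :=
    Lagrange.eval_interpolate_at_node _ Complex.ofReal_injective.injOn hx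
  rw [hq, Lagrange.eval_interpolate_not_at_node _ (hne x hx), mul_comm] at h1
  rw [← mul_right_cancel₀ (Lagrange.eval_nodal_not_at_node (hne x hx)) h1]
  refine Finset.sum_congr rfl fun i _ => ?_
  simp only [v, sub_neg_eq_add]
  ring

/-- The linear functionals on functions `ℝ → ℂ` that are finite combinations of evaluations at
positive reals. -/
def posEval : Submodule ℂ ((ℝ → ℂ) →ₗ[ℂ] ℂ) :=
  Submodule.span ℂ {L | ∃ x : ℝ, 0 < x ∧ L = LinearMap.proj x}

theorem proj_mem_posEval {x : ℝ} (hx : 0 < x) :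
    (LinearMap.proj x : (ℝ → ℂ) →ₗ[ℂ] ℂ) ∈ posEval :=
  Submodule.subset_span ⟨x, hx, rfl⟩

/-- A functional in `posEval` only sees the values of a function on a finite set. -/
theorem exists_finset_of_mem_posEval {L : (ℝ → ℂ) →ₗ[ℂ] ℂ} (hL : L ∈ posEval) :
    ∃ F : Finset ℝ, (∀ x ∈ F, 0 < x) ∧ ∀ f g : ℝ → ℂ, EqOn f g F → L f = L g := by
  classical
  induction hL using Submodule.span_induction with
  | mem L h =>
    obtain ⟨x, hx, rfl⟩ := h
    exact ⟨{x}, by simpa using hx, fun f g h => h (by simp)⟩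
  | zero => exact ⟨∅, by simp, fun _ _ _ => rfl⟩
  | add L M _ _ hL hM =>
    obtain ⟨F, hF, h1⟩ := hL
    obtain ⟨G, hG, h2⟩ := hM
    refine ⟨F ∪ G, fun x hx => (Finset.mem_union.1 hx).elim (hF x) (hG x), fun f g h => ?_⟩
    rw [LinearMap.add_apply, LinearMap.add_apply,
      h1 f g (h.mono (by simp)), h2 f g (h.mono (by simp))]
  | smul c L _ hL =>
    obtain ⟨F, hF, h1⟩ := hL
    exact ⟨F, hF, fun f g h => by rw [LinearMap.smul_apply, LinearMap.smul_apply, h1 f g h]⟩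

/-- The resolvent functions separate the functionals in `posEval`. -/
theorem eq_zero_of_mem_posEval {L : (ℝ → ℂ) →ₗ[ℂ] ℂ} (hL : L ∈ posEval)
    (h : ∀ t : ℝ, 0 < t → L (fun x => ((x : ℂ) + (t : ℂ))⁻¹) = 0) (f : ℝ → ℂ) : L f = 0 := by
  obtain ⟨F, hF, h1⟩ := exists_finset_of_mem_posEval hL
  obtain ⟨N, c, hc⟩ := exists_eq_sum_inv_add F hF f
  rw [h1 f (∑ i ∈ Finset.range N, c i • fun x : ℝ => ((x : ℂ) + ((i + 1 : ℝ) : ℂ))⁻¹)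
    (fun x hx => by simpa using hc x hx), map_sum]
  refine Finset.sum_eq_zero fun i _ => ?_
  rw [map_smul, h _ (by positivity), smul_zero]

theorem continuousOn_resolvent {L : (ℝ → ℂ) →ₗ[ℂ] ℂ} (hL : L ∈ posEval) :
    ContinuousOn (fun t : ℝ => L (fun x => ((x : ℂ) + (t : ℂ))⁻¹)) (Ioi 0) := by
  induction hL using Submodule.span_induction with
  | mem L h =>
    obtain ⟨x, hx, rfl⟩ := h
    simp only [LinearMap.proj_apply]
    refine ContinuousOn.inv₀ (by fun_prop) fun t ht => ?_
    have : 0 < x + t := add_pos hx ht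
    exact_mod_cast this.ne'
  | zero => exact continuousOn_const
  | add L M _ _ hL hM => exact hL.add hM
  | smul c L _ hL => exact continuousOn_const.mul hL

/-- The derivative at `t = 0` of `L (x ^ (i t))`, with `x ^ (i t)` written as an exponential. -/
theorem hasDerivAt_exp_log {L : (ℝ → ℂ) →ₗ[ℂ] ℂ} (hL : L ∈ posEval) :
    HasDerivAt (fun t : ℝ => L (fun x => Complex.exp (Complex.I * t * Real.log x)))
      (Complex.I * L (fun x => (Real.log x : ℂ))) 0 := by
  induction hL using Submodule.span_induction with
  | mem L h =>
    obtain ⟨x, hx, rfl⟩ := h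
    simp only [LinearMap.proj_apply]
    have h1 : HasDerivAt (fun t : ℝ => Complex.I * t * Real.log x)
        (Complex.I * 1 * Real.log x) 0 :=
      (((Complex.ofRealCLM.hasDerivAt (x := (0 : ℝ))).const_mul Complex.I).mul_const _)
    simpa using h1.cexp
  | zero => simpa using hasDerivAt_const (0 : ℝ) (0 : ℂ)
  | add L M _ _ hL hM => simpa only [LinearMap.add_apply, mul_add] using! hL.add hM
  | smul c L _ hL => simpa [mul_left_comm] using hL.const_mul c

/-- An integral representation of `g p` may be evaluated under a functional in `posEval`. -/
theorem integral_representation_of_mem_posEval {p C a b : ℝ} {α β : ℝ → ℝ}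
    (hrep : ∀ x : ℝ, 0 < x →
      IntegrableOn (fun t : ℝ => t ^ p * ((x + t)⁻¹ + α t + β t * x)) (Ioi 0) ∧
      g p x = a + b * x + C * ∫ t in Ioi (0 : ℝ), t ^ p * ((x + t)⁻¹ + α t + β t * x))
    {L : (ℝ → ℂ) →ₗ[ℂ] ℂ} (hL : L ∈ posEval) :
    IntegrableOn (fun t : ℝ => L (fun x => ((t ^ p * ((x + t)⁻¹ + α t + β t * x) : ℝ) : ℂ)))
      (Ioi 0) ∧
    L (fun x => (g p x : ℂ)) = a * L 1 + b * L (fun x => (x : ℂ)) +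
      C * ∫ t in Ioi (0 : ℝ), L (fun x => ((t ^ p * ((x + t)⁻¹ + α t + β t * x) : ℝ) : ℂ)) := by
  induction hL using Submodule.span_induction with
  | mem L h =>
    obtain ⟨x, hx, rfl⟩ := h
    simp only [LinearMap.proj_apply]
    obtain ⟨h1, h2⟩ := hrep x hx
    refine ⟨h1.ofReal, ?_⟩
    rw [h2, integral_complex_ofReal]
    push_cast
    simp
  | zero => simp
  | add L M _ _ hL hM =>
    refine ⟨hL.1.add hM.1, ?_⟩
    simp only [LinearMap.add_apply]
    rw [hL.2, hM.2, integral_add hL.1 hM.1]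
    ring
  | smul c L _ hL =>
    refine ⟨hL.1.const_mul c, ?_⟩
    simp only [LinearMap.smul_apply, smul_eq_mul]
    rw [hL.2, integral_const_mul]
    ring

/-- A functional in `posEval` that vanishes on affine functions, is nonnegative on the resolvent
functions and vanishes on `g p`, vanishes on the resolvent functions. -/
theorem resolvent_eq_zero_of_g_eq_zero {p : ℝ} (hp : p ∈ Ioo (0 : ℝ) 2)
    {L : (ℝ → ℂ) →ₗ[ℂ] ℂ} (hL : L ∈ posEval) (h1 : L 1 = 0) (hid : L (fun x => (x : ℂ)) = 0)
    (hpos : ∀ t : ℝ, 0 < t → 0 ≤ L (fun x => ((x : ℂ) + (t : ℂ))⁻¹))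
    (hg : L (fun x => (g p x : ℂ)) = 0) {t : ℝ} (ht : 0 < t) :
    L (fun x => ((x : ℂ) + (t : ℂ))⁻¹) = 0 := by
  obtain ⟨C, a, b, α, β, hC, hrep⟩ := g_integral_representation hp
  obtain ⟨hi, he⟩ := integral_representation_of_mem_posEval hrep hL
  set e : ℝ → ℝ := fun t => (L (fun x => ((x : ℂ) + (t : ℂ))⁻¹)).re with hedef
  have hLe : ∀ t : ℝ, 0 < t → L (fun x => ((x : ℂ) + (t : ℂ))⁻¹) = (e t : ℂ) := fun t ht =>
    Complex.eq_re_of_ofReal_le (r := 0) (by simpa using hpos t ht)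
  -- `L` kills the affine terms of the integrand, so `L (g p)` is `C ∫ t ^ p L ((x + t)⁻¹) dt`.
  have hk : EqOn (fun t : ℝ => L (fun x => ((t ^ p * ((x + t)⁻¹ + α t + β t * x) : ℝ) : ℂ)))
      (fun t => ((t ^ p * e t : ℝ) : ℂ)) (Ioi 0) := by
    intro t ht
    have : (fun x : ℝ => ((t ^ p * ((x + t)⁻¹ + α t + β t * x) : ℝ) : ℂ)) =
        ((t ^ p : ℝ) : ℂ) • ((fun x : ℝ => ((x : ℂ) + (t : ℂ))⁻¹) + (α t : ℂ) • (1 : ℝ → ℂ) +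
          (β t : ℂ) • (fun x : ℝ => (x : ℂ))) := by
      funext x
      simp
    simp only
    rw [this, map_smul, map_add, map_add, map_smul, map_smul, h1, hid, hLe t ht]
    simp
  rw [hg, h1, hid, setIntegral_congr_fun measurableSet_Ioi hk, integral_complex_ofReal] at he
  have hint : ∫ t in Ioi (0 : ℝ), t ^ p * e t = 0 := by
    have : (C : ℂ) ≠ 0 := by exact_mod_cast hC.ne'
    simp only [mul_zero, zero_add, zero_eq_mul, this, false_or] at he
    exact_mod_cast he
  have hint' : IntegrableOn (fun t : ℝ => t ^ p * e t) (Ioi 0) := by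
    have := (hi.congr_fun hk measurableSet_Ioi).re
    exact this
  have hnn : 0 ≤ᵐ[volume.restrict (Ioi 0)] fun t : ℝ => t ^ p * e t := by
    filter_upwards [ae_restrict_mem measurableSet_Ioi] with t ht
    exact mul_nonneg (Real.rpow_nonneg (le_of_lt ht) _) (Complex.nonneg_iff.1 (hpos t ht)).1
  have h0 := (integral_eq_zero_iff_of_nonneg_ae hnn hint').1 hint
  have hae : e =ᵐ[volume.restrict (Ioi 0)] fun _ => 0 := by
    filter_upwards [h0, ae_restrict_mem measurableSet_Ioi] with t h0 ht
    exact (mul_eq_zero.1 h0).resolve_left (Real.rpow_pos_of_pos ht _).ne'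
  -- Continuity in `t` turns vanishing almost everywhere into vanishing everywhere.
  have := Measure.eqOn_open_of_ae_eq hae isOpen_Ioi
    (Complex.continuous_re.comp_continuousOn (continuousOn_resolvent hL)) continuousOn_const ht
  rw [hLe t ht, this, Complex.ofReal_zero]

end Scalar

open Matrix

variable {n : Type*} [Fintype n] [DecidableEq n] {A B : Matrix n n ℂ}

/-! ### Functional calculus of a positive definite matrix -/

/-- The unitary matrix of eigenvectors of a positive definite matrix. -/
abbrev eigU (hA : A.PosDef) : Matrix n n ℂ := hA.isHermitian.eigenvectorUnitary

/-- The eigenvalues of a positive definite matrix, in the order of the columns of `eigU`. -/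
abbrev eigv (hA : A.PosDef) : n → ℝ := hA.isHermitian.eigenvalues

theorem star_eigU_mul (hA : A.PosDef) : (eigU hA)ᴴ * eigU hA = 1 :=
  Unitary.coe_star_mul_self hA.isHermitian.eigenvectorUnitary

theorem eigU_mul_star (hA : A.PosDef) : eigU hA * (eigU hA)ᴴ = 1 :=
  Unitary.coe_mul_star_self hA.isHermitian.eigenvectorUnitary

/-- The functional calculus of a positive definite matrix for complex valued functions, defined
through the eigenvector basis. -/
def posCalc (hA : A.PosDef) (f : ℝ → ℂ) : Matrix n n ℂ :=
  eigU hA * diagonal (fun i => f (eigv hA i)) * (eigU hA)ᴴ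

theorem cfc_eq_posCalc (hA : A.PosDef) (f : ℝ → ℝ) :
    cfc f A = posCalc hA (fun x => (f x : ℂ)) := by
  rw [hA.isHermitian.cfc_eq, IsHermitian.cfc, Unitary.conjStarAlgAut_apply]
  rfl

theorem posCalc_ofReal (hA : A.PosDef) : posCalc hA (fun x => (x : ℂ)) = A := by
  rw [← cfc_eq_posCalc hA (fun x => x)]
  exact cfc_id' ℝ A hA.isHermitian

theorem posCalc_one (hA : A.PosDef) : posCalc hA (fun _ => 1) = 1 := by
  simp [posCalc, eigU_mul_star]

theorem posCalc_mul (hA : A.PosDef) (f g : ℝ → ℂ) :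
    posCalc hA f * posCalc hA g = posCalc hA (fun x => f x * g x) := by
  simp only [posCalc]
  calc _ = eigU hA * diagonal (fun i => f (eigv hA i)) * ((eigU hA)ᴴ * eigU hA) *
        diagonal (fun i => g (eigv hA i)) * (eigU hA)ᴴ := by simp only [Matrix.mul_assoc]
    _ = _ := by
      rw [star_eigU_mul, Matrix.mul_one, Matrix.mul_assoc (eigU hA), diagonal_mul_diagonal]

theorem posCalc_congr (hA : A.PosDef) {f g : ℝ → ℂ} (h : ∀ x, 0 < x → f x = g x) :
    posCalc hA f = posCalc hA g := by
  simp only [posCalc, fun i => h _ (hA.eigenvalues_pos i)]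

theorem posCalc_inv (hA : A.PosDef) : posCalc hA (fun x => (x : ℂ)⁻¹) = A⁻¹ := by
  refine (Matrix.inv_eq_right_inv ?_).symm
  nth_rw 1 [← posCalc_ofReal hA]
  rw [posCalc_mul, ← posCalc_one hA]
  refine posCalc_congr hA fun x hx => mul_inv_cancel₀ ?_
  exact_mod_cast hx.ne'

theorem cpowM_eq_posCalc (hA : A.PosDef) (z : ℂ) :
    cpowM A z = posCalc hA (fun x => Complex.exp (z * Real.log x)) := by
  have hinv : (eigU hA)⁻¹ = (eigU hA)ᴴ := Matrix.inv_eq_right_inv (eigU_mul_star hA)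
  have hu : IsUnit (eigU hA) := ⟨⟨_, _, eigU_mul_star hA, star_eigU_mul hA⟩, rfl⟩
  rw [cpowM, logM, cfc_eq_posCalc hA, posCalc, ← smul_mul_assoc, ← mul_smul_comm, ← diagonal_smul,
    ← hinv, Matrix.exp_conj _ _ hu, Matrix.exp_diagonal, hinv, posCalc]
  congr 3
  funext i
  rw [Pi.coe_exp, Complex.exp_eq_exp_ℂ]
  simp

/-! ### Functional calculus of the relative modular operator -/

/-- The functional calculus `f ↦ f(Δ_{AB})` of the relative modular operator, for complex valued
functions. In eigenvector bases of `A` and `B`, with eigenvalues `a i` and `b k`, the operator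
multiplies the `(i, k)` entry by `f (a i / b k)`. -/
def modCalc (hA : A.PosDef) (hB : B.PosDef) :
    (ℝ → ℂ) →ₐ[ℂ] Module.End ℂ (Matrix n n ℂ) :=
  AlgHom.ofLinearMap
    { toFun := fun f =>
        { toFun := fun X => eigU hA * (Matrix.of fun i k =>
            f (eigv hA i / eigv hB k) * ((eigU hA)ᴴ * X * eigU hB) i k) * (eigU hB)ᴴ
          map_add' := fun X Y => by
            rw [← Matrix.add_mul, ← Matrix.mul_add]
            congr 2
            ext i k
            simp [Matrix.add_mul, mul_add]
          map_smul' := fun c X => by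
            rw [RingHom.id_apply, ← smul_mul_assoc, ← mul_smul_comm]
            congr 2
            ext i k
            simp [mul_left_comm] }
      map_add' := fun f g => by
        refine LinearMap.ext fun X => ?_
        simp only [LinearMap.add_apply, LinearMap.coe_mk, AddHom.coe_mk]
        rw [← Matrix.add_mul, ← Matrix.mul_add]
        congr 2
        ext i k
        simp [add_mul]
      map_smul' := fun c f => by
        refine LinearMap.ext fun X => ?_
        simp only [LinearMap.smul_apply, LinearMap.coe_mk, AddHom.coe_mk, RingHom.id_apply]
        rw [← smul_mul_assoc, ← mul_smul_comm]
        congr 2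
        ext i k
        simp [mul_assoc] }
    (by
      refine LinearMap.ext fun X => ?_
      simp only [LinearMap.coe_mk, AddHom.coe_mk, Pi.one_apply, one_mul, Module.End.one_apply]
      change eigU hA * ((eigU hA)ᴴ * X * eigU hB) * (eigU hB)ᴴ = X
      rw [Matrix.mul_assoc _ X, ← Matrix.mul_assoc, eigU_mul_star, Matrix.one_mul,
        Matrix.mul_assoc, eigU_mul_star, Matrix.mul_one])
    (fun f g => by
      refine LinearMap.ext fun X => ?_
      simp only [LinearMap.coe_mk, AddHom.coe_mk, Module.End.mul_apply]
      have h : ∀ Z, (eigU hA)ᴴ * (eigU hA * Z * (eigU hB)ᴴ) * eigU hB = Z := fun Z => by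
        rw [Matrix.mul_assoc _ Z, ← Matrix.mul_assoc, star_eigU_mul, Matrix.one_mul,
          Matrix.mul_assoc, star_eigU_mul, Matrix.mul_one]
      rw [h]
      congr 2
      ext i k
      simp [mul_assoc])

theorem modCalc_apply (hA : A.PosDef) (hB : B.PosDef) (f : ℝ → ℂ) (X : Matrix n n ℂ) :
    modCalc hA hB f X = eigU hA * (Matrix.of fun i k =>
      f (eigv hA i / eigv hB k) * ((eigU hA)ᴴ * X * eigU hB) i k) * (eigU hB)ᴴ :=
  rfl

theorem modCalc_congr (hA : A.PosDef) (hB : B.PosDef) {f g : ℝ → ℂ}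
    (h : ∀ i k, f (eigv hA i / eigv hB k) =
      g (eigv hA i / eigv hB k)) :
    modCalc hA hB f = modCalc hA hB g := by
  refine LinearMap.ext fun X => ?_
  simp only [modCalc_apply, h]

theorem modCalc_congr_of_pos (hA : A.PosDef) (hB : B.PosDef) {f g : ℝ → ℂ}
    (h : ∀ x, 0 < x → f x = g x) : modCalc hA hB f = modCalc hA hB g :=
  modCalc_congr hA hB fun i k => h _ (div_pos (hA.eigenvalues_pos i) (hB.eigenvalues_pos k))

theorem posCalc_mul_mul_posCalc (hA : A.PosDef) (hB : B.PosDef) (φ ψ : ℝ → ℂ)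
    (X : Matrix n n ℂ) :
    posCalc hA φ * X * posCalc hB ψ = eigU hA * (Matrix.of fun i k =>
      φ (eigv hA i) * ψ (eigv hB k) * ((eigU hA)ᴴ * X * eigU hB) i k) *
        (eigU hB)ᴴ := by
  have : (Matrix.of fun i k => φ (eigv hA i) * ψ (eigv hB k) *
      ((eigU hA)ᴴ * X * eigU hB) i k) =
      diagonal (fun i => φ (eigv hA i)) * ((eigU hA)ᴴ * X * eigU hB) *
        diagonal (fun i => ψ (eigv hB i)) := by
    ext i k
    rw [mul_diagonal, diagonal_mul, of_apply]
    ring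
  rw [this, posCalc, posCalc]
  simp only [Matrix.mul_assoc]

/-- If `f (a / b) = φ a * ψ b`, then `f(Δ_{AB})` is multiplication by `φ(A)` on the left and by
`ψ(B)` on the right. -/
theorem modCalc_eq_posCalc_mul_mul (hA : A.PosDef) (hB : B.PosDef) {f φ ψ : ℝ → ℂ}
    (h : ∀ a b, 0 < a → 0 < b → f (a / b) = φ a * ψ b) (X : Matrix n n ℂ) :
    modCalc hA hB f X = posCalc hA φ * X * posCalc hB ψ := by
  simp only [posCalc_mul_mul_posCalc, modCalc_apply,
    fun i k => h _ _ (hA.eigenvalues_pos i) (hB.eigenvalues_pos k)]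

theorem modCalc_ofReal (hA : A.PosDef) (hB : B.PosDef) :
    modCalc hA hB (fun x => (x : ℂ)) = modularOp A B := by
  refine LinearMap.ext fun X => ?_
  rw [modCalc_eq_posCalc_mul_mul hA hB (φ := fun x => (x : ℂ)) (ψ := fun x => (x : ℂ)⁻¹)
    (fun a b _ _ => by push_cast; rw [div_eq_mul_inv]), posCalc_ofReal, posCalc_inv hB]
  simp [modularOp, Matrix.mul_assoc]

theorem modCalc_log (hA : A.PosDef) (hB : B.PosDef) (X : Matrix n n ℂ) :
    modCalc hA hB (fun x => (Real.log x : ℂ)) X = logM A * X - X * logM B := by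
  have h1 := posCalc_mul_mul_posCalc hA hB (fun x => (Real.log x : ℂ)) (fun _ => 1) X
  have h2 := posCalc_mul_mul_posCalc hA hB (fun _ => 1) (fun x => (Real.log x : ℂ)) X
  rw [posCalc_one, Matrix.mul_one] at h1
  rw [posCalc_one, Matrix.one_mul] at h2
  rw [logM, logM, cfc_eq_posCalc hA, cfc_eq_posCalc hB, h1, h2, modCalc_apply,
    ← Matrix.sub_mul, ← Matrix.mul_sub]
  congr 2
  ext i k
  simp only [Matrix.sub_apply, of_apply,
    Real.log_div (hA.eigenvalues_pos i).ne' (hB.eigenvalues_pos k).ne']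
  push_cast
  ring

theorem modCalc_cpow (hA : A.PosDef) (hB : B.PosDef) (z : ℂ) (X : Matrix n n ℂ) :
    cpowM A z * X * cpowM B (-z) =
      modCalc hA hB (fun x => Complex.exp (z * Real.log x)) X := by
  rw [cpowM_eq_posCalc hA, cpowM_eq_posCalc hB]
  refine (modCalc_eq_posCalc_mul_mul hA hB (fun a b ha hb => ?_) X).symm
  rw [← Complex.exp_add, Real.log_div ha.ne' hb.ne']
  push_cast
  ring_nf

theorem modCalc_mul_posCalc (hA : A.PosDef) (hB : B.PosDef) (f ψ : ℝ → ℂ)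
    (X : Matrix n n ℂ) :
    modCalc hA hB f (X * posCalc hB ψ) = modCalc hA hB f X * posCalc hB ψ := by
  rw [modCalc_apply, modCalc_apply, posCalc]
  have h1 : (eigU hA)ᴴ * (X * (eigU hB * diagonal (fun i => ψ (eigv hB i)) *
      (eigU hB)ᴴ)) * eigU hB =
      (eigU hA)ᴴ * X * eigU hB * diagonal (fun i => ψ (eigv hB i)) := by
    simp only [Matrix.mul_assoc, star_eigU_mul, Matrix.mul_one]
  have h2 : (Matrix.of fun i k => f (eigv hA i / eigv hB k) *
      ((eigU hA)ᴴ * X * eigU hB * diagonal (fun i => ψ (eigv hB i))) i k) =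
      (Matrix.of fun i k => f (eigv hA i / eigv hB k) *
        ((eigU hA)ᴴ * X * eigU hB) i k) * diagonal (fun i => ψ (eigv hB i)) := by
    ext i k
    simp only [mul_diagonal, of_apply, mul_assoc]
  rw [h1, h2]
  simp only [Matrix.mul_assoc]
  rw [← Matrix.mul_assoc (eigU hB)ᴴ (eigU hB), star_eigU_mul, Matrix.one_mul]

theorem modularOp_add_smul_one (hA : A.PosDef) (hB : B.PosDef) (t : ℝ) :
    modularOp A B + (t : ℂ) • 1 = modCalc hA hB (fun x => (x : ℂ) + (t : ℂ)) := by
  rw [← modCalc_ofReal hA hB, ← map_one (modCalc hA hB), ← map_smul, ← map_add]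
  congr 1
  funext x
  simp

theorem modularOp_add_mul_resolvent (hA : A.PosDef) (hB : B.PosDef) {t : ℝ} (ht : 0 < t) :
    (modularOp A B + (t : ℂ) • 1) * modCalc hA hB (fun x => ((x : ℂ) + (t : ℂ))⁻¹) = 1 := by
  rw [modularOp_add_smul_one hA hB, ← map_mul, ← map_one (modCalc hA hB)]
  have hne : ∀ x : ℝ, 0 < x → (x : ℂ) + (t : ℂ) ≠ 0 := fun x hx => by
    have : 0 < x + t := add_pos hx ht
    exact_mod_cast this.ne'
  exact modCalc_congr_of_pos hA hB fun x hx => mul_inv_cancel₀ (hne x hx)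

theorem inverse_modularOp_add (hA : A.PosDef) (hB : B.PosDef) {t : ℝ} (ht : 0 < t) :
    Ring.inverse (modularOp A B + (t : ℂ) • 1) =
      modCalc hA hB (fun x => ((x : ℂ) + (t : ℂ))⁻¹) := by
  have h := modularOp_add_mul_resolvent hA hB ht
  refine Ring.inverse_unit ⟨_, _, h, ?_⟩
  rwa [modularOp_add_smul_one hA hB, ← map_mul, mul_comm, map_mul, ← modularOp_add_smul_one hA hB]

/-- `Δ_{AB}` is self-adjoint for the Hilbert–Schmidt inner product; its matrix is the Kronecker
product of `A` and the transpose of `B⁻¹`. -/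
theorem isHermitian_toMatrix_modularOp (hA : A.IsHermitian) (hB : B.IsHermitian) :
    (LinearMap.toMatrix (Matrix.stdBasis ℂ n n) (Matrix.stdBasis ℂ n n)
      (modularOp A B)).IsHermitian := by
  have hB' : B⁻¹.IsHermitian := hB.inv
  have key : ∀ p q : n × n, LinearMap.toMatrix (Matrix.stdBasis ℂ n n) (Matrix.stdBasis ℂ n n)
      (modularOp A B) p q = A p.1 q.1 * B⁻¹ q.2 p.2 := by
    rintro ⟨i, k⟩ ⟨j, l⟩
    rw [LinearMap.toMatrix_apply, stdBasis_eq_single]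
    have : ∀ X : Matrix n n ℂ, (Matrix.stdBasis ℂ n n).repr X (i, k) = X i k := fun X => rfl
    rw [this]
    simp [modularOp, Matrix.mul_apply, Matrix.single, Finset.sum_ite_eq, ite_and]
  ext p q
  rw [conjTranspose_apply, key, key, star_mul', ← hA.apply p.1 q.1, ← hB'.apply q.2 p.2]

/-- The functional calculus through the matrix of `Δ_{AB}` in the basis of matrix units agrees with
the explicit one. -/
theorem opCalc_modularOp (hA : A.PosDef) (hB : B.PosDef) (f : ℝ → ℝ) :
    opCalc f (modularOp A B) = modCalc hA hB (fun x => (f x : ℂ)) := by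
  classical
  set M := LinearMap.toMatrix (Matrix.stdBasis ℂ n n) (Matrix.stdBasis ℂ n n) (modularOp A B)
    with hM
  have hsa : M.IsHermitian := isHermitian_toMatrix_modularOp hA.isHermitian hB.isHermitian
  have hfin : (spectrum ℝ M).Finite := Matrix.finite_real_spectrum
  -- Interpolate `f` on the eigenvalues of `Δ_{AB}`: both sides are then the same polynomial in
  -- `Δ_{AB}`.
  let F : Finset ℝ := hfin.toFinset ∪ Finset.univ.image
    (fun p : n × n => eigv hA p.1 / eigv hB p.2)
  let q := Lagrange.interpolate F (fun x : ℝ => x) f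
  have hq : ∀ x ∈ F, q.eval x = f x := fun x hx =>
    Lagrange.eval_interpolate_at_node f Function.injective_id.injOn hx
  have h1 : cfc f M = Polynomial.aeval M (q.map (algebraMap ℝ ℂ)) := by
    rw [Polynomial.aeval_map_algebraMap, ← cfc_polynomial q M hsa]
    exact cfc_congr fun x hx => (hq x (Finset.mem_union_left _ (hfin.mem_toFinset.2 hx))).symm
  have h2 : M = (Matrix.toLinAlgEquiv (Matrix.stdBasis ℂ n n)).symm (modularOp A B) := rfl
  have h3 : opCalc f (modularOp A B) =
      Polynomial.aeval (modularOp A B) (q.map (algebraMap ℝ ℂ)) := by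
    rw [opCalc, ← hM, h1]
    change Matrix.toLinAlgEquiv (Matrix.stdBasis ℂ n n) _ = _
    rw [h2, ← Polynomial.aeval_algHom_apply]
    simp
  rw [h3, ← modCalc_ofReal hA hB, Polynomial.aeval_algHom_apply]
  refine modCalc_congr hA hB fun i k => ?_
  rw [← hq _ (Finset.mem_union_right _ (Finset.mem_image.2 ⟨(i, k), Finset.mem_univ _, rfl⟩))]
  generalize eigv hA i / eigv hB k = x
  have := Polynomial.aeval_algHom_apply (Pi.evalAlgHom ℂ (fun _ : ℝ => ℂ) x)
    (fun x : ℝ => (x : ℂ)) (q.map (algebraMap ℝ ℂ))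
  simp only [Pi.evalAlgHom_apply] at this
  rw [← this, Polynomial.aeval_map_algebraMap]
  exact Polynomial.aeval_algebraMap_apply ℂ x q

/-- The factors `√B` in `J p K A B` combine to `B`, because `g_p(Δ_{AB})` commutes with right
multiplication by functions of `B`. -/
theorem J_eq_trace (hA : A.PosDef) (hB : B.PosDef) (p : ℝ) (K : Matrix n n ℂ) :
    J p K A B = (Kᴴ * modCalc hA hB (fun x => (g p x : ℂ)) K * B).trace := by
  have hs : posCalc hB (fun x => (Real.sqrt x : ℂ)) * posCalc hB (fun x => (Real.sqrt x : ℂ)) =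
      B := by
    rw [posCalc_mul]
    refine Eq.trans ?_ (posCalc_ofReal hB)
    refine posCalc_congr hB fun x hx => ?_
    rw [← Complex.ofReal_mul, Real.mul_self_sqrt hx.le]
  rw [J, opCalc_modularOp hA hB, cfc_eq_posCalc hB, modCalc_mul_posCalc, ← Matrix.mul_assoc,
    trace_mul_comm, ← Matrix.mul_assoc, ← Matrix.mul_assoc, hs, Matrix.mul_assoc, trace_mul_comm]

/-- `f ↦ ℓ (f(Δ_{AB}) X)` for a linear functional `ℓ`, as a functional of `f`. -/
def modFunctional (hA : A.PosDef) (hB : B.PosDef) (X : Matrix n n ℂ)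
    (ℓ : Matrix n n ℂ →ₗ[ℂ] ℂ) : (ℝ → ℂ) →ₗ[ℂ] ℂ :=
  ℓ ∘ₗ LinearMap.applyₗ X ∘ₗ (modCalc hA hB).toLinearMap

theorem modFunctional_apply (hA : A.PosDef) (hB : B.PosDef) (X : Matrix n n ℂ)
    (ℓ : Matrix n n ℂ →ₗ[ℂ] ℂ) (f : ℝ → ℂ) :
    modFunctional hA hB X ℓ f = ℓ (modCalc hA hB f X) :=
  rfl

/-- `f ↦ ℓ (f(Δ_{AB}) X)` evaluates `f` at the eigenvalues of `Δ_{AB}` only. -/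
theorem modFunctional_mem_posEval (hA : A.PosDef) (hB : B.PosDef) (X : Matrix n n ℂ)
    (ℓ : Matrix n n ℂ →ₗ[ℂ] ℂ) : modFunctional hA hB X ℓ ∈ posEval := by
  set Y := (eigU hA)ᴴ * X * eigU hB with hY
  have : modFunctional hA hB X ℓ = ∑ i, ∑ k,
      ℓ (eigU hA * single i k (Y i k) * (eigU hB)ᴴ) •
        (LinearMap.proj (eigv hA i / eigv hB k) : (ℝ → ℂ) →ₗ[ℂ] ℂ) := by
    refine LinearMap.ext fun f => ?_
    rw [modFunctional_apply, modCalc_apply, ← hY, matrix_eq_sum_single (Matrix.of _)]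
    simp only [Matrix.mul_sum, Matrix.sum_mul, map_sum, LinearMap.sum_apply, LinearMap.smul_apply,
      LinearMap.proj_apply, of_apply]
    refine Finset.sum_congr rfl fun i _ => Finset.sum_congr rfl fun k _ => ?_
    rw [← smul_eq_mul (f _) (Y i k), ← smul_single, mul_smul_comm, smul_mul_assoc, map_smul,
      smul_eq_mul, smul_eq_mul, mul_comm]
  rw [this]
  exact Submodule.sum_mem _ fun i _ => Submodule.sum_mem _ fun k _ => Submodule.smul_mem _ _
    (proj_mem_posEval (div_pos (hA.eigenvalues_pos i) (hB.eigenvalues_pos k)))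

/-! ### The Sylvester operator `Y ↦ A Y + t Y B` -/

/-- `Y ↦ A Y + t Y B` is self-adjoint for the Hilbert–Schmidt inner product. -/
theorem trace_conjTranspose_mul_sylvester {m : Type*} [Fintype m] {A B : Matrix m m ℂ}
    (hA : A.IsHermitian) (hB : B.IsHermitian) (t : ℝ) (X Y : Matrix m m ℂ) :
    (Xᴴ * (A * Y + (t : ℂ) • (Y * B))).trace = ((A * X + (t : ℂ) • (X * B))ᴴ * Y).trace := by
  rw [conjTranspose_add, conjTranspose_smul, conjTranspose_mul, conjTranspose_mul, hA.eq, hB.eq,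
    Matrix.mul_add, Matrix.add_mul, trace_add, trace_add, Matrix.mul_assoc, mul_smul_comm,
    smul_mul_assoc, trace_smul, trace_smul, ← Matrix.mul_assoc Xᴴ Y B, trace_mul_comm (Xᴴ * Y) B,
    ← Matrix.mul_assoc B]
  simp

/-- `D ↦ A D + t D B` is positive definite for the Hilbert–Schmidt inner product. -/
theorem trace_sylvester_nonneg (hA : A.PosDef) (hB : B.PosDef) {t : ℝ} (ht : 0 < t)
    (D : Matrix n n ℂ) : 0 ≤ (Dᴴ * (A * D + (t : ℂ) • (D * B))).trace ∧
      ((Dᴴ * (A * D + (t : ℂ) • (D * B))).trace = 0 → D = 0) := by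
  have h1 : (Dᴴ * A * D).PosSemidef := hA.posSemidef.conjTranspose_mul_mul_same D
  have h2 : 0 ≤ (D * B * Dᴴ).trace := (hB.posSemidef.mul_mul_conjTranspose_same D).trace_nonneg
  have h3 : 0 ≤ (t : ℂ) * (D * B * Dᴴ).trace :=
    mul_nonneg (by exact_mod_cast ht.le) h2
  have he : (Dᴴ * (A * D + (t : ℂ) • (D * B))).trace =
      (Dᴴ * A * D).trace + (t : ℂ) * (D * B * Dᴴ).trace := by
    rw [Matrix.mul_add, trace_add, mul_smul_comm, trace_smul, trace_mul_comm Dᴴ (D * B),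
      Matrix.mul_assoc Dᴴ, smul_eq_mul]
  rw [he]
  refine ⟨add_nonneg h1.trace_nonneg h3, fun h => ?_⟩
  have h4 : Dᴴ * A * D = 0 :=
    h1.trace_eq_zero_iff.1 ((add_eq_zero_iff_of_nonneg h1.trace_nonneg h3).1 h).1
  have h5 : ∀ x, D *ᵥ x = 0 := fun x => by
    by_contra hx
    have := hA.dotProduct_mulVec_pos hx
    rw [star_mulVec, ← dotProduct_mulVec, mulVec_mulVec, mulVec_mulVec, h4] at this
    simp at this
  exact Matrix.ext_of_mulVec_single fun i => by rw [h5, zero_mulVec]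

/-- `(Δ_{AB} + t)⁻¹ K` is the solution `W` of the Sylvester equation `A W + t W B = K B`. -/
theorem sylvester_resolvent (hA : A.PosDef) (hB : B.PosDef) {t : ℝ} (ht : 0 < t)
    (K : Matrix n n ℂ) :
    A * modCalc hA hB (fun x => ((x : ℂ) + (t : ℂ))⁻¹) K +
      (t : ℂ) • (modCalc hA hB (fun x => ((x : ℂ) + (t : ℂ))⁻¹) K * B) = K * B := by
  set W := modCalc hA hB (fun x => ((x : ℂ) + (t : ℂ))⁻¹) K with hW
  have h : (modularOp A B + (t : ℂ) • 1) W = K := by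
    rw [hW, ← Module.End.mul_apply, modularOp_add_mul_resolvent hA hB ht, Module.End.one_apply]
  have hu : IsUnit B.det := (Matrix.isUnit_iff_isUnit_det _).1 hB.isUnit
  conv_rhs => rw [← h]
  simp [modularOp, Matrix.add_mul, Matrix.mul_assoc, Matrix.nonsing_inv_mul _ hu]

/-- The functional `X ↦ Tr K* X B`. -/
def traceForm (K B : Matrix n n ℂ) : Matrix n n ℂ →ₗ[ℂ] ℂ :=
  traceLinearMap n ℂ ℂ ∘ₗ LinearMap.mulLeft ℂ Kᴴ ∘ₗ LinearMap.mulRight ℂ B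

theorem traceForm_apply (K B X : Matrix n n ℂ) : traceForm K B X = (Kᴴ * X * B).trace := by
  simp [traceForm, Matrix.mul_assoc]

/-! ### The convexity defect -/

variable {ι : Type*} [Fintype ι] {Aj Bj : ι → Matrix n n ℂ}

/-- The convexity defect of `(A, B) ↦ Tr K* (Δ_{AB} + t)⁻¹(K) B` as a sum of squares: completing the
square works because the operator `S(Y) = A Y + t Y B` and the vector `K B` are both additive in
`(A, B)`. -/
theorem sum_traceForm_resolvent_sub (hAj : ∀ j, (Aj j).PosDef)
    (hBj : ∀ j, (Bj j).PosDef) (hAs : A = ∑ j, Aj j) (hBs : B = ∑ j, Bj j) (K : Matrix n n ℂ)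
    {t : ℝ} {Wj : ι → Matrix n n ℂ} {W : Matrix n n ℂ}
    (hWj : ∀ j, Aj j * Wj j + (t : ℂ) • (Wj j * Bj j) = K * Bj j)
    (hW : A * W + (t : ℂ) • (W * B) = K * B) :
    ∑ j, traceForm K (Bj j) (Wj j) - traceForm K B W =
      ∑ j, ((Wj j - W)ᴴ * (Aj j * (Wj j - W) + (t : ℂ) • ((Wj j - W) * Bj j))).trace := by
  have hK : ∀ {B' : Matrix n n ℂ}, B'.IsHermitian →
      ∀ Y, ((K * B')ᴴ * Y).trace = traceForm K B' Y := by
    intro B' hB' Y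
    rw [traceForm_apply, conjTranspose_mul, hB'.eq, Matrix.mul_assoc, trace_mul_comm]
  have hj : ∀ j, ((Wj j - W)ᴴ * (Aj j * (Wj j - W) + (t : ℂ) • ((Wj j - W) * Bj j))).trace =
      traceForm K (Bj j) (Wj j) - traceForm K (Bj j) W - (Wᴴ * (K * Bj j)).trace +
        (Wᴴ * (Aj j * W + (t : ℂ) • (W * Bj j))).trace := by
    intro j
    have e1 : Aj j * (Wj j - W) + (t : ℂ) • ((Wj j - W) * Bj j) =
        K * Bj j - (Aj j * W + (t : ℂ) • (W * Bj j)) := by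
      rw [← hWj j, Matrix.mul_sub, Matrix.sub_mul, smul_sub]
      abel
    have e2 := trace_conjTranspose_mul_sylvester (hAj j).isHermitian (hBj j).isHermitian t (Wj j) W
    have e3 := trace_conjTranspose_mul_sylvester (hAj j).isHermitian (hBj j).isHermitian t
      (Wj j) (Wj j)
    rw [hWj, hK (hBj j).isHermitian] at e2 e3
    rw [e1, conjTranspose_sub, Matrix.sub_mul, trace_sub, Matrix.mul_sub, Matrix.mul_sub, trace_sub,
      trace_sub, e2, e3]
    ring
  have s1 : ∑ j, (Wᴴ * (K * Bj j)).trace = (Wᴴ * (K * B)).trace := by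
    rw [hBs, Matrix.mul_sum, Matrix.mul_sum, trace_sum]
  have s2 : ∑ j, (Wᴴ * (Aj j * W + (t : ℂ) • (W * Bj j))).trace = (Wᴴ * (K * B)).trace := by
    rw [← hW, hAs, hBs, Matrix.sum_mul, Matrix.mul_sum, Finset.smul_sum, ← Finset.sum_add_distrib,
      Matrix.mul_sum, trace_sum]
  have s3 : ∑ j, traceForm K (Bj j) W = traceForm K B W := by
    simp only [traceForm_apply]
    rw [hBs, Matrix.mul_sum, trace_sum]
  simp only [hj, Finset.sum_add_distrib, Finset.sum_sub_distrib, s1, s2, s3]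
  ring

/-- The defect `∑ j, Tr K* f(Δ_{A_j B_j})(K) B_j - Tr K* f(Δ_{AB})(K) B` as a functional of `f`. -/
def defect (hA : A.PosDef) (hB : B.PosDef) (hAj : ∀ j, (Aj j).PosDef) (hBj : ∀ j, (Bj j).PosDef)
    (K : Matrix n n ℂ) : (ℝ → ℂ) →ₗ[ℂ] ℂ :=
  ∑ j, modFunctional (hAj j) (hBj j) K (traceForm K (Bj j)) -
    modFunctional hA hB K (traceForm K B)

theorem defect_apply (hA : A.PosDef) (hB : B.PosDef) (hAj : ∀ j, (Aj j).PosDef)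
    (hBj : ∀ j, (Bj j).PosDef) (K : Matrix n n ℂ) (f : ℝ → ℂ) :
    defect hA hB hAj hBj K f = ∑ j, traceForm K (Bj j) (modCalc (hAj j) (hBj j) f K) -
      traceForm K B (modCalc hA hB f K) := by
  simp [defect, modFunctional_apply]

theorem defect_mem_posEval (hA : A.PosDef) (hB : B.PosDef) (hAj : ∀ j, (Aj j).PosDef)
    (hBj : ∀ j, (Bj j).PosDef) (K : Matrix n n ℂ) : defect hA hB hAj hBj K ∈ posEval :=
  Submodule.sub_mem _ (Submodule.sum_mem _ fun j _ => modFunctional_mem_posEval (hAj j) (hBj j) _ _)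
    (modFunctional_mem_posEval hA hB _ _)

theorem defect_one (hA : A.PosDef) (hB : B.PosDef) (hAj : ∀ j, (Aj j).PosDef)
    (hBj : ∀ j, (Bj j).PosDef) (hBs : B = ∑ j, Bj j) (K : Matrix n n ℂ) :
    defect hA hB hAj hBj K 1 = 0 := by
  rw [defect_apply, sub_eq_zero]
  simp only [map_one, Module.End.one_apply, traceForm_apply]
  rw [← trace_sum, ← Matrix.mul_sum, ← hBs]

theorem traceForm_modCalc_ofReal_mul (hA : A.PosDef) (hB : B.PosDef) (f : ℝ → ℂ)
    (K : Matrix n n ℂ) :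
    traceForm K B (modCalc hA hB (fun x => (x : ℂ) * f x) K) =
      (Kᴴ * A * modCalc hA hB f K).trace := by
  have hu : IsUnit B.det := (Matrix.isUnit_iff_isUnit_det _).1 hB.isUnit
  have : (fun x : ℝ => (x : ℂ) * f x) = (fun x : ℝ => (x : ℂ)) * f := rfl
  rw [this, map_mul, modCalc_ofReal hA hB, traceForm_apply]
  simp [modularOp, Matrix.mul_assoc, Matrix.nonsing_inv_mul _ hu]

theorem defect_ofReal (hA : A.PosDef) (hB : B.PosDef) (hAj : ∀ j, (Aj j).PosDef)
    (hBj : ∀ j, (Bj j).PosDef) (hAs : A = ∑ j, Aj j) (K : Matrix n n ℂ) :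
    defect hA hB hAj hBj K (fun x => (x : ℂ)) = 0 := by
  have : (fun x : ℝ => (x : ℂ)) = fun x : ℝ => (x : ℂ) * (1 : ℝ → ℂ) x := by simp
  rw [defect_apply, sub_eq_zero, this]
  simp only [traceForm_modCalc_ofReal_mul hA hB,
    fun j => traceForm_modCalc_ofReal_mul (hAj j) (hBj j), map_one, Module.End.one_apply]
  rw [hAs, ← trace_sum, Matrix.mul_sum, Matrix.sum_mul]

theorem J_eq_sum_iff_defect (hA : A.PosDef) (hB : B.PosDef) (hAj : ∀ j, (Aj j).PosDef)
    (hBj : ∀ j, (Bj j).PosDef) (p : ℝ) (K : Matrix n n ℂ) :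
    J p K A B = ∑ j, J p K (Aj j) (Bj j) ↔
      defect hA hB hAj hBj K (fun x => (g p x : ℂ)) = 0 := by
  simp only [defect_apply, sub_eq_zero, traceForm_apply, J_eq_trace hA hB,
    fun j => J_eq_trace (hAj j) (hBj j)]
  exact eq_comm

theorem defect_resolvent_nonneg (hA : A.PosDef) (hB : B.PosDef) (hAj : ∀ j, (Aj j).PosDef)
    (hBj : ∀ j, (Bj j).PosDef) (hAs : A = ∑ j, Aj j) (hBs : B = ∑ j, Bj j) (K : Matrix n n ℂ)
    {t : ℝ} (ht : 0 < t) :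
    0 ≤ defect hA hB hAj hBj K (fun x => ((x : ℂ) + (t : ℂ))⁻¹) := by
  rw [defect_apply, sum_traceForm_resolvent_sub hAj hBj hAs hBs K
    (fun j => sylvester_resolvent (hAj j) (hBj j) ht K) (sylvester_resolvent hA hB ht K)]
  exact Finset.sum_nonneg fun j _ => (trace_sylvester_nonneg (hAj j) (hBj j) ht _).1

/-- Equality in the convexity of the resolvent functional forces equality of the resolvents. -/
theorem resolvent_eq_of_defect_eq_zero (hA : A.PosDef) (hB : B.PosDef) (hAj : ∀ j, (Aj j).PosDef)
    (hBj : ∀ j, (Bj j).PosDef) (hAs : A = ∑ j, Aj j) (hBs : B = ∑ j, Bj j) (K : Matrix n n ℂ)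
    {t : ℝ} (ht : 0 < t) (h : defect hA hB hAj hBj K (fun x => ((x : ℂ) + (t : ℂ))⁻¹) = 0) (j : ι) :
    modCalc (hAj j) (hBj j) (fun x => ((x : ℂ) + (t : ℂ))⁻¹) K =
      modCalc hA hB (fun x => ((x : ℂ) + (t : ℂ))⁻¹) K := by
  rw [defect_apply, sum_traceForm_resolvent_sub hAj hBj hAs hBs K
    (fun j => sylvester_resolvent (hAj j) (hBj j) ht K) (sylvester_resolvent hA hB ht K),
    Finset.sum_eq_zero_iff_of_nonneg
      (fun j _ => (trace_sylvester_nonneg (hAj j) (hBj j) ht _).1)] at h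
  exact sub_eq_zero.1 ((trace_sylvester_nonneg (hAj j) (hBj j) ht _).2 (h j (Finset.mem_univ j)))

theorem defect_eq_zero_of_modCalc_eq (hA : A.PosDef) (hB : B.PosDef) (hAj : ∀ j, (Aj j).PosDef)
    (hBj : ∀ j, (Bj j).PosDef) (hBs : B = ∑ j, Bj j) (K : Matrix n n ℂ) {f : ℝ → ℂ}
    (h : ∀ j, modCalc (hAj j) (hBj j) f K = modCalc hA hB f K) :
    defect hA hB hAj hBj K f = 0 := by
  rw [defect_apply, sub_eq_zero]
  simp only [h, traceForm_apply]
  rw [← trace_sum, ← Matrix.mul_sum, ← hBs]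

/-- Equality in the logarithmic condition alone suffices for `x log x`, because
`Tr K* (x log x)(Δ_{AB})(K) B = Tr K* A (log A K - K log B)` is linear in `A` once
`log A K - K log B` is fixed. -/
theorem defect_g_one (hA : A.PosDef) (hB : B.PosDef) (hAj : ∀ j, (Aj j).PosDef)
    (hBj : ∀ j, (Bj j).PosDef) (hAs : A = ∑ j, Aj j) (K : Matrix n n ℂ)
    (h : ∀ j, modCalc (hAj j) (hBj j) (fun x => (Real.log x : ℂ)) K =
      modCalc hA hB (fun x => (Real.log x : ℂ)) K) :
    defect hA hB hAj hBj K (fun x => (g 1 x : ℂ)) = 0 := by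
  have : (fun x : ℝ => (g 1 x : ℂ)) = fun x : ℝ => (x : ℂ) * (Real.log x : ℂ) := by
    funext x
    simp [g]
  rw [this, defect_apply, sub_eq_zero]
  simp only [traceForm_modCalc_ofReal_mul hA hB,
    fun j => traceForm_modCalc_ofReal_mul (hAj j) (hBj j), h]
  rw [← trace_sum, ← Matrix.sum_mul, ← Matrix.mul_sum, ← hAs]

/-! ### Transfer between functions of two modular operators -/

section Pair

variable {A' B' : Matrix n n ℂ} (hA : A.PosDef) (hB : B.PosDef) (hA' : A'.PosDef) (hB' : B'.PosDef)
  (K : Matrix n n ℂ)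

theorem modFunctional_sub_mem_posEval (ℓ : Matrix n n ℂ →ₗ[ℂ] ℂ) :
    modFunctional hA hB K ℓ - modFunctional hA' hB' K ℓ ∈ posEval :=
  Submodule.sub_mem _ (modFunctional_mem_posEval hA hB _ _) (modFunctional_mem_posEval hA' hB' _ _)

/-- If the resolvents of two modular operators agree on `K`, so do all functions of them. -/
theorem modCalc_eq_of_resolvent_eq
    (h : ∀ t : ℝ, 0 < t → modCalc hA hB (fun x => ((x : ℂ) + (t : ℂ))⁻¹) K =
      modCalc hA' hB' (fun x => ((x : ℂ) + (t : ℂ))⁻¹) K) (f : ℝ → ℂ) :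
    modCalc hA hB f K = modCalc hA' hB' f K := by
  ext i k
  refine sub_eq_zero.1 (eq_zero_of_mem_posEval
    (modFunctional_sub_mem_posEval hA hB hA' hB' K (entryLinearMap ℂ ℂ i k)) (fun t ht => ?_) f)
  rw [LinearMap.sub_apply, modFunctional_apply, modFunctional_apply, h t ht, sub_self]

/-- Differentiating `Δ ^ (it) K` at `t = 0` gives `i (log Δ) K`. -/
theorem modCalc_log_eq_of_exp_eq
    (h : ∀ t : ℝ, 0 < t →
      modCalc hA hB (fun x => Complex.exp (Complex.I * t * Real.log x)) K =
      modCalc hA' hB' (fun x => Complex.exp (Complex.I * t * Real.log x)) K) :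
    modCalc hA hB (fun x => (Real.log x : ℂ)) K =
      modCalc hA' hB' (fun x => (Real.log x : ℂ)) K := by
  ext i k
  have hd := (hasDerivAt_exp_log (modFunctional_sub_mem_posEval hA hB hA' hB' K
    (entryLinearMap ℂ ℂ i k))).hasDerivWithinAt (s := Set.Ici 0)
  have h0 : HasDerivWithinAt (fun _ : ℝ => (0 : ℂ)) 0 (Set.Ici 0) 0 := hasDerivWithinAt_const _ _ _
  have hz : ∀ t ∈ Set.Ici (0 : ℝ), (modFunctional hA hB K (entryLinearMap ℂ ℂ i k) -
      modFunctional hA' hB' K (entryLinearMap ℂ ℂ i k))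
        (fun x => Complex.exp (Complex.I * t * Real.log x)) = 0 := by
    intro t ht
    rw [LinearMap.sub_apply, modFunctional_apply, modFunctional_apply, sub_eq_zero]
    rcases (Set.mem_Ici.1 ht).eq_or_lt with rfl | ht
    · have : (fun x : ℝ => Complex.exp (Complex.I * (0 : ℝ) * Real.log x)) = 1 := by
        funext x
        simp
      rw [this, map_one, map_one]
    · rw [h t ht]
  have := (uniqueDiffOn_Ici (0 : ℝ) 0 Set.self_mem_Ici).eq_deriv _ hd
    (h0.congr hz (hz 0 Set.self_mem_Ici))
  exact sub_eq_zero.1 ((mul_eq_zero.1 this).resolve_left Complex.I_ne_zero)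

end Pair

end WYD
end

theorem mainTheorem3 {n ι : Type*} [Fintype n] [DecidableEq n] [Fintype ι] [Nonempty ι]
    (K A B : Matrix n n ℂ) (Aj Bj : ι → Matrix n n ℂ)
    (hAj : ∀ j, (Aj j).PosDef) (hBj : ∀ j, (Bj j).PosDef)
    (hA : A = ∑ j, Aj j) (hB : B = ∑ j, Bj j) :
    List.TFAE [
      ∀ p ∈ Set.Ioo (0 : ℝ) 2, WYD.J p K A B = ∑ j, WYD.J p K (Aj j) (Bj j),
      ∃ p ∈ Set.Ioo (0 : ℝ) 2, WYD.J p K A B = ∑ j, WYD.J p K (Aj j) (Bj j),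
      ∀ j, ∀ t : ℝ, 0 < t →
        Ring.inverse (WYD.modularOp (Aj j) (Bj j) + (t : ℂ) • 1) K =
          Ring.inverse (WYD.modularOp A B + (t : ℂ) • 1) K,
      ∀ j, ∀ t : ℝ, 0 < t →
        WYD.cpowM (Aj j) (Complex.I * t) * K * WYD.cpowM (Bj j) (-(Complex.I * t)) =
          WYD.cpowM A (Complex.I * t) * K * WYD.cpowM B (-(Complex.I * t)),
      ∀ j, (WYD.logM A - WYD.logM (Aj j)) * K = K * (WYD.logM B - WYD.logM (Bj j))] := by
  have pA : A.PosDef := by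
    rw [hA]
    exact Matrix.posDef_sum Finset.univ_nonempty fun j _ => hAj j
  have pB : B.PosDef := by
    rw [hB]
    exact Matrix.posDef_sum Finset.univ_nonempty fun j _ => hBj j
  simp only [WYD.J_eq_sum_iff_defect pA pB hAj hBj, WYD.modCalc_cpow pA pB,
    fun j => WYD.modCalc_cpow (hAj j) (hBj j)]
  have hlog : ∀ j, (WYD.logM A - WYD.logM (Aj j)) * K = K * (WYD.logM B - WYD.logM (Bj j)) ↔
      WYD.modCalc (hAj j) (hBj j) (fun x => (Real.log x : ℂ)) K =
        WYD.modCalc pA pB (fun x => (Real.log x : ℂ)) K := by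
    intro j
    rw [WYD.modCalc_log pA pB, WYD.modCalc_log (hAj j) (hBj j), Matrix.sub_mul, Matrix.mul_sub,
      sub_eq_sub_iff_sub_eq_sub, eq_comm]
  simp only [hlog]
  tfae_have 1 → 2 := fun h => ⟨1, by norm_num, h 1 (by norm_num)⟩
  tfae_have 2 → 3 := by
    rintro ⟨p, hp, h⟩ j t ht
    rw [WYD.inverse_modularOp_add pA pB ht, WYD.inverse_modularOp_add (hAj j) (hBj j) ht]
    exact WYD.resolvent_eq_of_defect_eq_zero pA pB hAj hBj hA hB K ht
      (WYD.resolvent_eq_zero_of_g_eq_zero hp (WYD.defect_mem_posEval pA pB hAj hBj K)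
        (WYD.defect_one pA pB hAj hBj hB K) (WYD.defect_ofReal pA pB hAj hBj hA K)
        (fun s hs => WYD.defect_resolvent_nonneg pA pB hAj hBj hA hB K hs) h ht) j
  have hres : (∀ j, ∀ t : ℝ, 0 < t →
        Ring.inverse (WYD.modularOp (Aj j) (Bj j) + (t : ℂ) • 1) K =
          Ring.inverse (WYD.modularOp A B + (t : ℂ) • 1) K) →
      ∀ j f, WYD.modCalc (hAj j) (hBj j) f K = WYD.modCalc pA pB f K := by
    intro h j f
    refine WYD.modCalc_eq_of_resolvent_eq (hAj j) (hBj j) pA pB K (fun t ht => ?_) f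
    rw [← WYD.inverse_modularOp_add pA pB ht, ← WYD.inverse_modularOp_add (hAj j) (hBj j) ht,
      h j t ht]
  tfae_have 3 → 1 := fun h p _ =>
    WYD.defect_eq_zero_of_modCalc_eq pA pB hAj hBj hB K fun j => hres h j _
  tfae_have 3 → 4 := fun h j t _ => hres h j _
  tfae_have 4 → 5 := fun h j =>
    WYD.modCalc_log_eq_of_exp_eq (hAj j) (hBj j) pA pB K (h j)
  tfae_have 5 → 2 := fun h => ⟨1, by norm_num, WYD.defect_g_one pA pB hAj hBj hA K h⟩
  tfae_finish
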